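/- Let $(X,\mathcal B,\mu)$ be a probability space, and let $\Psi_r$, $\Phi_s$, $T_t$ ($r,s,t\in\mathbb R$) be ergodic measure-preserving flows on it, that is, weakly continuous one-parameter groups of automorphisms of $(X,\mathcal B,\mu)$, considered modulo null sets (every jointly measurable measure-preserving action of $\mathbb R$ is such a flow). Suppose that $$\Psi_r\Phi_s=T_{rs}\Phi_s\Psi_r\qquad\text{for all } r,s\in\mathbb R,$$ that every $T_t$ commutes with every $\Psi_r$ and with every $\Phi_s$, and that the flow $T_t$ is weakly mixing, i.e. for all measurable $A,B$ $$\frac1L\int_0^L\bigl|\mu(A\cap T_tB)-\mu(A)\mu(B)\bigr|\,dt\to0\qquad(L\to+\infty).$$ Then the flows $\Psi_r$ and $\Phi_s$ are mixing of all orders: for $S=\Psi$ and for $S=\Phi$, for every $k\ge1$ and all measurable sets $A_0,A_1,\dots,A_k$, $$\mu\bigl(A_0\cap S_{m_1}A_1\cap S_{m_1+m_2}A_2\cap\dots\cap S_{m_1+\dots+m_k}A_k\bigr)\to\mu(A_0)\mu(A_1)\cdots\mu(A_k)$$ as the real numbers $m_1,\dots,m_k$ tend to $+\infty$. -/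

import Mathlib

open MeasureTheory Filter Set
open scoped Topology symmDiff

/-- A measure-preserving flow on `(X, μ)`: a one-parameter group of automorphisms of the measure
space, continuous in the weak topology. As usual in ergodic theory, automorphisms are considered
modulo null sets, so the group law is required almost everywhere. `ofMeasurable` below shows that
every jointly measurable measure-preserving action of `ℝ` is a flow in this sense. -/
structure MeasureFlow {X : Type*} [MeasurableSpace X] (μ : Measure X) where
  /-- The time `t` map. -/
  toFun : ℝ → X → X
  measurePreserving : ∀ t, MeasurePreserving (toFun t) μ μ
  map_zero : ∀ᵐ x ∂μ, toFun 0 x = x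
  map_add : ∀ s t, ∀ᵐ x ∂μ, toFun (s + t) x = toFun s (toFun t x)
  tendsto_symmDiff : ∀ A, MeasurableSet A →
    Tendsto (fun t : ℝ => μ ((toFun t ⁻¹' A) ∆ A)) (𝓝 0) (𝓝 0)

namespace MeasureFlow

variable {X : Type*} [MeasurableSpace X] {μ : Measure X}

instance : CoeFun (MeasureFlow μ) (fun _ => ℝ → X → X) := ⟨toFun⟩

/-- A jointly measurable measure-preserving action of `ℝ` on a probability space is a flow. -/
def ofMeasurable [IsProbabilityMeasure μ] (T : ℝ → X → X)
    (hT : Measurable fun p : ℝ × X => T p.1 p.2)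
    (hpres : ∀ t A, MeasurableSet A → μ (T t ⁻¹' A) = μ A)
    (hzero : ∀ x, T 0 x = x) (hadd : ∀ s t x, T (s + t) x = T s (T t x)) :
    MeasureFlow μ where
  toFun := T
  measurePreserving t :=
    have hTt : Measurable (T t) := hT.comp measurable_prodMk_left
    ⟨hTt, by
      ext A hA
      rw [Measure.map_apply hTt hA, hpres t A hA]⟩
  map_zero := .of_forall hzero
  map_add s t := .of_forall (hadd s t)
  tendsto_symmDiff A hA := by
    have hmeas : ∀ t : ℝ, Measurable fun p : X × ℝ => T (p.2 + t) p.1 := fun t =>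
      hT.comp (by fun_prop : Measurable fun p : X × ℝ => (p.2 + t, p.1))
    have hmeas0 : Measurable fun p : X × ℝ => T p.2 p.1 := hT.comp measurable_swap
    let D : ℝ → Set (X × ℝ) := fun t =>
      ((fun p : X × ℝ => T (p.2 + t) p.1) ⁻¹' A) ∆ ((fun p : X × ℝ => T p.2 p.1) ⁻¹' A)
    have hD : ∀ t, MeasurableSet (D t) := fun t => (hmeas t hA).symmDiff (hmeas0 hA)
    let ν : Measure ℝ := volume.restrict (Icc 0 1)
    have : IsProbabilityMeasure ν := ⟨by simp [ν]⟩
    -- the measure of `D t` does not depend on the averaging over `[0, 1]`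
    have h1 : ∀ t, μ ((T t ⁻¹' A) ∆ A) = μ.prod ν (D t) := by
      intro t
      rw [Measure.prod_apply_symm (hD t)]
      have : ∀ s : ℝ, μ ((fun x => (x, s)) ⁻¹' D t) = μ ((T t ⁻¹' A) ∆ A) := by
        intro s
        have hTt : Measurable (T t) := hT.comp measurable_prodMk_left
        rw [← hpres s _ ((hTt hA).symmDiff hA)]
        congr 1
        ext x
        simp [D, mem_symmDiff, add_comm s t, hadd t s x]
      simp [this]
    have h2 : Tendsto (fun t => μ.prod ν (D t)) (𝓝 0) (𝓝 0) := by
      simp_rw [Measure.prod_apply (hD _)]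
      have key := tendsto_lintegral_filter_of_dominated_convergence (μ := μ) (l := 𝓝 (0 : ℝ))
        (F := fun t x => ν (Prod.mk x ⁻¹' D t)) (f := fun _ => 0) (fun _ => 1)
        (.of_forall fun t => measurable_measure_prodMk_left (hD t))
        (.of_forall fun t => .of_forall fun x => prob_le_one) (by simp) ?_
      · simpa using key
      refine .of_forall fun x => ?_
      let S : Set ℝ := {s | T s x ∈ A} ∩ Icc (-1) 2
      have hS : MeasurableSet S :=
        ((hT.comp (measurable_prodMk_right (y := x))) hA).inter measurableSet_Icc
      have hSfin : volume S ≠ ⊤ :=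
        ((measure_mono inter_subset_right).trans_lt (by simp)).ne
      have htr : Tendsto (fun t : ℝ => volume (((fun s : ℝ => s + t) ⁻¹' S) ∆ S)) (𝓝 0) (𝓝 0) := by
        have hc : Continuous fun t : ℝ => (ContinuousMap.mk (fun s : ℝ => s + t) : C(ℝ, ℝ)) :=
          ContinuousMap.continuous_of_continuous_uncurry _ (by
            change Continuous fun p : ℝ × ℝ => p.2 + p.1
            fun_prop)
        have := tendsto_measure_symmDiff_preimage_nhds_zero (μ := (volume : Measure ℝ))
          (ν := (volume : Measure ℝ)) (hc.tendsto 0)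
          (.of_forall fun t => measurePreserving_add_right volume t)
          (measurePreserving_add_right volume 0) hS.nullMeasurableSet hSfin
        simpa using this
      refine tendsto_of_tendsto_of_tendsto_of_le_of_le' tendsto_const_nhds htr
        (.of_forall fun _ => zero_le) ?_
      filter_upwards [Icc_mem_nhds (a := (-1 : ℝ)) (b := 1) (x := 0) (by norm_num) (by norm_num)]
        with t ht
      have hms : MeasurableSet (Prod.mk x ⁻¹' D t) := measurable_prodMk_left (hD t)
      rw [Measure.restrict_apply hms]
      refine measure_mono ?_
      rintro s ⟨hs, hs0, hs1⟩
      have h3 : s + t ∈ Icc (-1 : ℝ) 2 := ⟨by linarith [ht.1], by linarith [ht.2]⟩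
      have h4 : s ∈ Icc (-1 : ℝ) 2 := ⟨by linarith, by linarith⟩
      have hs' : (T (s + t) x ∈ A ∧ T s x ∉ A) ∨ (T s x ∈ A ∧ T (s + t) x ∉ A) := hs
      rcases hs' with h | h
      · exact Or.inl ⟨⟨h.1, h3⟩, fun h' => h.2 h'.1⟩
      · exact Or.inr ⟨⟨h.1, h4⟩, fun h' => h.2 h'.1⟩
    simpa only [h1] using h2

/-- A flow is ergodic if every invariant measurable set is null or conull. -/
def IsErgodic (T : MeasureFlow μ) : Prop :=
  ∀ A, MeasurableSet A → (∀ t, T t ⁻¹' A =ᵐ[μ] A) → μ A = 0 ∨ μ Aᶜ = 0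

/-- The image `T_t A` of a set under the time `t` map of the flow, written as the preimage of `A`
under the time `-t` map, which is the inverse of the time `t` map modulo null sets. -/
def image (T : MeasureFlow μ) (t : ℝ) (A : Set X) : Set X := T (-t) ⁻¹' A

/-- A flow on a probability space is weakly mixing if `|μ(A ∩ T_t B) - μ(A) μ(B)|` tends to zero
in Cesàro mean as `t → +∞`, for all measurable `A`, `B`. -/
def IsWeaklyMixing (T : MeasureFlow μ) : Prop :=
  ∀ A B, MeasurableSet A → MeasurableSet B →
    Tendsto (fun L : ℝ => L⁻¹ * ∫ t in (0 : ℝ)..L, |μ.real (A ∩ T.image t B) - μ.real A * μ.real B|)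
      atTop (𝓝 0)

/-- Mixing of order `k` of a flow on a probability space:
`μ(A₀ ∩ T_{m₁} A₁ ∩ T_{m₁+m₂} A₂ ∩ … ∩ T_{m₁+…+m_k} A_k) → μ(A₀) μ(A₁) ⋯ μ(A_k)`
for all measurable `A₀, …, A_k` as the real numbers `m₁, …, m_k` all tend to `+∞`
(independently of each other). The empty sum gives time `0` for `A₀`. -/
def IsMixingOfOrder (T : MeasureFlow μ) (k : ℕ) : Prop :=
  ∀ A : Fin (k + 1) → Set X, (∀ i, MeasurableSet (A i)) →
    Tendsto (fun m : Fin k → ℝ =>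
        μ.real (⋂ i : Fin (k + 1), T.image (∑ j : Fin k with j.val < i.val, m j) (A i)))
      (Filter.pi fun _ => atTop) (𝓝 (∏ i, μ.real (A i)))

end MeasureFlow

/-!
The relation `Ψ_r Φ_s = T_{rs} Φ_s Ψ_r` says that conjugation by `Φ_s` multiplies `Ψ_r` by the
central element `T_{rs}`. A correlation `∫ f₀(Ψ_{b₀} x) ⋯ f_k(Ψ_{b_k} x) dμ` with widely spaced times
`b_i` is therefore invariant, after replacing each `f_i` by `f_i ∘ Φ_s` (which is close to `f_i` in
`L¹` when `s` is small), under composing `f_i` with `T_{s (b_i - b₀)}`. Taking `s = t / (b_k - b₀)`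
with `t` fixed, `s` tends to zero, and the correlation is asymptotically unchanged when `f_i` is
composed with `T_{t c_i}`, where `c_i` is the limit of `(b_i - b₀) / (b_k - b₀)` along an ultrafilter;
in particular `c₀ = 0` and `c_k = 1`. This is `MeasureFlow.IsHeisenberg.tendsto_corr_sub`.

Mixing for tuples of functions (`MeasureFlow.IsTupleMixing`) then follows by induction on the number
of functions. One may assume that the last function `h` is the indicator function of a set minus
its mean, since constants are covered by the induction hypothesis and indicator functions span a
dense subspace of `L¹`. The correlation is averaged over the shifts `t = 0, τ, …, (N - 1) τ`; the
function `f₀` is not affected by them, and the Cauchy–Schwarz inequality removes it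
(`sq_average_integral_mul_le`). The square of the correlation is thus asymptotically at most the
average over pairs `(i, j)` of correlations of one function less, whose limits are given by the
induction hypothesis and are bounded by `1`, and by `|∫ h · h ∘ T_{(j - i) τ}|` when `i < j`. Since `T`
is weakly mixing, `τ` can be chosen such that all these autocorrelations are small
(`MeasureFlow.IsWeaklyMixing.exists_small_correlations`), so that the average is at most `1 / N` plus
a small error (`MeasureFlow.IsHeisenberg.tendsto_corr_zero`).

The roles of `Ψ` and `Φ` are symmetric up to the sign of the time of `T`.
-/

/-! ### Reduction to indicator functions, and strong continuity of flows -/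

section Auxiliary

variable {X : Type*} [MeasurableSpace X] {μ : Measure X}

/-- A density argument: a family of subadditive functionals, bounded uniformly by the `L¹` norm,
that tends to zero at multiples of indicator functions tends to zero at every integrable
function. -/
theorem tendsto_zero_of_indicator {ι : Type*} {l : Filter ι} (D : ι → (X → ℝ) → ℝ) (C : ℝ)
    (hnonneg : ∀ p f, 0 ≤ D p f)
    (hadd : ∀ p f g, Integrable f μ → Integrable g μ → D p (f + g) ≤ D p f + D p g)
    (hbound : ∀ p f, Integrable f μ → D p f ≤ C * ∫ x, |f x| ∂μ)
    (hind : ∀ (c : ℝ) (A : Set X), MeasurableSet A →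
      Tendsto (fun p => D p (A.indicator fun _ => c)) l (𝓝 0))
    {f : X → ℝ} (hf : Integrable f μ) : Tendsto (fun p => D p f) l (𝓝 0) := by
  -- perturbation by a function of small `L¹` norm
  have hpert : ∀ f g : X → ℝ, Integrable f μ → Integrable g μ → ∀ p,
      D p g ≤ D p f + C * ∫ x, |g x - f x| ∂μ := by
    intro f g hf hg p
    calc D p g = D p (f + (g - f)) := by rw [add_sub_cancel]
      _ ≤ D p f + D p (g - f) := hadd p f _ hf (hg.sub hf)
      _ ≤ _ := by gcongr; exact hbound p _ (hg.sub hf)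
  refine Integrable.induction (fun f => Tendsto (fun p => D p f) l (𝓝 0))
    (fun c A hA _ => hind c A hA) ?_ ?_ ?_ hf
  · intro f g _ hf hg hDf hDg
    exact squeeze_zero (fun p => hnonneg p _) (fun p => hadd p f g hf hg)
      (by simpa using hDf.add hDg)
  · refine isClosed_of_closure_subset fun g hg => ?_
    rw [mem_ofPred_eq, Metric.tendsto_nhds]
    intro ε hε
    obtain ⟨f, hf, hfg⟩ := Metric.mem_closure_iff.1 hg (ε / (2 * (|C| + 1))) (by positivity)
    have hf' : Tendsto (fun p => D p f) l (𝓝 0) := hf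
    rw [L1.dist_eq_integral_dist] at hfg
    simp only [Real.dist_eq] at hfg
    filter_upwards [hf'.eventually (gt_mem_nhds (half_pos hε))] with p hp
    rw [Real.dist_eq, sub_zero, abs_of_nonneg (hnonneg p _)]
    refine (hpert _ _ (L1.integrable_coeFn f) (L1.integrable_coeFn g) p).trans_lt ?_
    have h0 : 0 ≤ ∫ x, |g x - f x| ∂μ := integral_nonneg fun x => abs_nonneg _
    have h1 : C * ∫ x, |g x - f x| ∂μ ≤ (|C| + 1) * (ε / (2 * (|C| + 1))) :=
      mul_le_mul ((le_abs_self C).trans (by linarith)) hfg.le h0 (by positivity)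
    have h2 : (|C| + 1) * (ε / (2 * (|C| + 1))) = ε / 2 := by
      have : |C| + 1 ≠ 0 := by positivity
      field_simp
    linarith
  · intro f g hfg hf hDf
    refine squeeze_zero (fun p => hnonneg p _) (fun p => ?_) hDf
    have h0 : ∫ x, |g x - f x| ∂μ = 0 := by
      refine integral_eq_zero_of_ae ?_
      filter_upwards [hfg] with x hx
      simp [hx]
    simpa [h0] using hpert f g hf (hf.congr hfg) p

theorem MeasureTheory.MeasurePreserving.integral_comp_aestronglyMeasurable {g : X → X}
    (hg : MeasurePreserving g μ μ) {f : X → ℝ} (hf : AEStronglyMeasurable f μ) :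
    ∫ x, f (g x) ∂μ = ∫ x, f x ∂μ := by
  have hf' : AEStronglyMeasurable f (μ.map g) := by rwa [hg.map_eq]
  rw [← integral_map hg.aemeasurable hf', hg.map_eq]

theorem abs_prod_le_one {ι : Type*} (s : Finset ι) {a : ι → ℝ} (ha : ∀ i, |a i| ≤ 1) :
    |∏ i ∈ s, a i| ≤ 1 := by
  rw [Finset.abs_prod]
  exact Finset.prod_le_one (fun i _ => abs_nonneg _) fun i _ => ha i

theorem abs_prod_sub_prod_le {ι : Type*} (s : Finset ι) {a b : ι → ℝ} (ha : ∀ i, |a i| ≤ 1)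
    (hb : ∀ i, |b i| ≤ 1) : |∏ i ∈ s, a i - ∏ i ∈ s, b i| ≤ ∑ i ∈ s, |a i - b i| := by
  classical
  induction s using Finset.induction_on with
  | empty => simp
  | insert j s hj ih =>
    rw [Finset.prod_insert hj, Finset.prod_insert hj, Finset.sum_insert hj]
    calc |a j * ∏ i ∈ s, a i - b j * ∏ i ∈ s, b i|
        = |(a j - b j) * ∏ i ∈ s, a i + b j * (∏ i ∈ s, a i - ∏ i ∈ s, b i)| := by ring_nf
      _ ≤ |a j - b j| * |∏ i ∈ s, a i| + |b j| * |∏ i ∈ s, a i - ∏ i ∈ s, b i| := by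
        rw [← abs_mul, ← abs_mul]; exact abs_add_le _ _
      _ ≤ |a j - b j| * 1 + 1 * ∑ i ∈ s, |a i - b i| := by
        gcongr
        · exact abs_prod_le_one s ha
        · exact hb j
      _ = _ := by ring

theorem integrable_of_abs_le_one [IsFiniteMeasure μ] {f : X → ℝ} (hf : Measurable f)
    (h1 : ∀ x, |f x| ≤ 1) : Integrable f μ :=
  Integrable.of_bound hf.aestronglyMeasurable 1 (.of_forall h1)

theorem abs_integral_le_one [IsProbabilityMeasure μ] {f : X → ℝ} (h1 : ∀ x, |f x| ≤ 1) :
    |∫ x, f x ∂μ| ≤ 1 := by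
  simpa using norm_integral_le_of_norm_le_const (μ := μ) (f := f) (.of_forall h1)

end Auxiliary

namespace MeasureFlow

variable {X : Type*} [MeasurableSpace X] {μ : Measure X}

theorem measurable (R : MeasureFlow μ) (s : ℝ) : Measurable (R s) :=
  (R.measurePreserving s).measurable

theorem integral_comp (R : MeasureFlow μ) (s : ℝ) {f : X → ℝ} (hf : AEStronglyMeasurable f μ) :
    ∫ x, f (R s x) ∂μ = ∫ x, f x ∂μ :=
  (R.measurePreserving s).integral_comp_aestronglyMeasurable hf

theorem integrable_comp (R : MeasureFlow μ) (s : ℝ) {f : X → ℝ} (hf : Integrable f μ) :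
    Integrable (fun x => f (R s x)) μ :=
  (R.measurePreserving s).integrable_comp_of_integrable hf

/-- A flow acts on `L¹` as a strongly continuous group. -/
theorem tendsto_integral_abs_comp_sub [IsFiniteMeasure μ] (R : MeasureFlow μ) {f : X → ℝ}
    (hf : Integrable f μ) : Tendsto (fun s => ∫ x, |f (R s x) - f x| ∂μ) (𝓝 0) (𝓝 0) := by
  refine tendsto_zero_of_indicator (fun s f => ∫ x, |f (R s x) - f x| ∂μ) 2
    (fun s f => integral_nonneg fun x => abs_nonneg _) ?_ ?_ ?_ hf
  · intro s f g hf hg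
    have hf' := ((R.integrable_comp s hf).sub hf).abs
    have hg' := ((R.integrable_comp s hg).sub hg).abs
    refine (integral_mono (((R.integrable_comp s (hf.add hg)).sub (hf.add hg)).abs)
      (hf'.add hg') fun x => ?_).trans_eq (integral_add hf' hg')
    have := abs_add_le (f (R s x) - f x) (g (R s x) - g x)
    simp only [Pi.add_apply, Pi.sub_apply]
    rwa [add_sub_add_comm]
  · intro s f hf
    have hf' := R.integrable_comp s hf
    refine (integral_mono ((hf'.sub hf).abs) (hf'.abs.add hf.abs)
      fun x => abs_sub (f (R s x)) (f x)).trans_eq ?_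
    refine (integral_add hf'.abs hf.abs).trans ?_
    rw [R.integral_comp s (f := fun x => |f x|) hf.abs.aestronglyMeasurable, two_mul]
  · intro c A hA
    have h : ∀ s, ∫ x, |A.indicator (fun _ => c) (R s x) - A.indicator (fun _ => c) x| ∂μ
        = μ.real ((R s ⁻¹' A) ∆ A) * |c| := by
      intro s
      rw [← smul_eq_mul, ← integral_indicator_const _ ((R.measurable s hA).symmDiff hA)]
      congr 1
      ext x
      by_cases h1 : R s x ∈ A <;> by_cases h2 : x ∈ A <;> simp [h1, h2, mem_symmDiff, indicator]
    simp_rw [h]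
    have := ((ENNReal.tendsto_toReal ENNReal.zero_ne_top).comp
      (R.tendsto_symmDiff A hA)).mul_const |c|
    simpa [Measure.real, Function.comp_def] using this

theorem integral_abs_comp_sub_comp [IsFiniteMeasure μ] (R : MeasureFlow μ) {f : X → ℝ}
    (hf : Integrable f μ) (s t : ℝ) :
    ∫ x, |f (R s x) - f (R t x)| ∂μ = ∫ x, |f (R (s - t) x) - f x| ∂μ := by
  rw [← R.integral_comp t (f := fun x => |f (R (s - t) x) - f x|)
    (((R.integrable_comp (s - t) hf).sub hf).abs.aestronglyMeasurable)]
  refine integral_congr_ae ?_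
  filter_upwards [R.map_add (s - t) t] with x hx
  rw [← hx, sub_add_cancel]

/-! ### Small correlations of a weakly mixing flow -/

theorem continuous_integral_mul_comp [IsFiniteMeasure μ] (T : MeasureFlow μ) {g f : X → ℝ}
    (hg : Measurable g) (hg1 : ∀ x, |g x| ≤ 1) (hf : Integrable f μ) :
    Continuous fun t => ∫ x, g x * f (T t x) ∂μ := by
  have hint : ∀ t, Integrable (fun x => g x * f (T t x)) μ := fun t =>
    (T.integrable_comp t hf).bdd_mul hg.aestronglyMeasurable (.of_forall hg1)
  refine continuous_iff_continuousAt.2 fun t₀ => tendsto_iff_dist_tendsto_zero.2 ?_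
  have hlim : Tendsto (fun t => ∫ x, |f (T (t - t₀) x) - f x| ∂μ) (𝓝 t₀) (𝓝 0) :=
    (T.tendsto_integral_abs_comp_sub hf).comp (by
      simpa using (continuous_id.sub continuous_const).tendsto t₀ (f := fun t : ℝ => t - t₀))
  refine squeeze_zero (fun _ => dist_nonneg) (fun t => ?_) hlim
  rw [← T.integral_abs_comp_sub_comp hf, Real.dist_eq, ← integral_sub (hint t) (hint t₀)]
  refine abs_integral_le_integral_abs.trans (integral_mono ((hint t).sub (hint t₀)).abs
    ((T.integrable_comp t hf).sub (T.integrable_comp t₀ hf)).abs fun x => ?_)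
  rw [← mul_sub, abs_mul]
  exact mul_le_of_le_one_left (abs_nonneg _) (hg1 x)

/-- The indicator function of a set, centred to have mean zero. -/
noncomputable def centeredIndicator (μ : Measure X) (A : Set X) (x : X) : ℝ :=
  A.indicator (fun _ => (1 : ℝ)) x - μ.real A

theorem measurable_centeredIndicator {A : Set X} (hA : MeasurableSet A) :
    Measurable (centeredIndicator μ A) :=
  (measurable_const.indicator hA).sub_const _

theorem abs_centeredIndicator_le_one [IsProbabilityMeasure μ] (A : Set X) (x : X) :
    |centeredIndicator μ A x| ≤ 1 := by
  have h0 : 0 ≤ μ.real A := measureReal_nonneg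
  have h1 : μ.real A ≤ 1 := measureReal_le_one
  by_cases hx : x ∈ A <;> simp only [centeredIndicator, hx, indicator_of_mem,
    indicator_of_notMem, not_false_eq_true] <;> rw [abs_le] <;> constructor <;> linarith

theorem integral_centeredIndicator_mul_comp [IsProbabilityMeasure μ] (T : MeasureFlow μ) (t : ℝ)
    {A : Set X} (hA : MeasurableSet A) :
    ∫ x, centeredIndicator μ A x * centeredIndicator μ A (T t x) ∂μ
      = μ.real (A ∩ T.image (-t) A) - μ.real A * μ.real A := by
  have hB : MeasurableSet (T t ⁻¹' A) := T.measurable t hA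
  have hi : ∀ B : Set X, MeasurableSet B → Integrable (B.indicator fun _ => (1 : ℝ)) μ :=
    fun B hB => (integrable_const 1).indicator hB
  have hI : ∀ B : Set X, MeasurableSet B →
      ∫ x, B.indicator (fun _ => (1 : ℝ)) x ∂μ = μ.real B := fun B hB => by
    simp [integral_indicator_const _ hB]
  have hpt : ∀ x, centeredIndicator μ A x * centeredIndicator μ A (T t x)
      = ((A ∩ T t ⁻¹' A).indicator (fun _ => (1 : ℝ)) x
          - μ.real A * (T t ⁻¹' A).indicator (fun _ => (1 : ℝ)) x)
        - (μ.real A * A.indicator (fun _ => (1 : ℝ)) x - μ.real A * μ.real A) := by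
    intro x
    by_cases h1 : x ∈ A <;> by_cases h2 : T t x ∈ A <;>
      simp [centeredIndicator, indicator, h1, h2] <;> ring
  simp_rw [hpt]
  have h1 : Integrable (fun x => (A ∩ T t ⁻¹' A).indicator (fun _ => (1 : ℝ)) x
      - μ.real A * (T t ⁻¹' A).indicator (fun _ => (1 : ℝ)) x) μ :=
    (hi _ (hA.inter hB)).sub ((hi _ hB).const_mul _)
  have h2 : Integrable (fun x => μ.real A * A.indicator (fun _ => (1 : ℝ)) x
      - μ.real A * μ.real A) μ := ((hi _ hA).const_mul _).sub (integrable_const _)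
  rw [integral_sub h1 h2, integral_sub (hi _ (hA.inter hB)) ((hi _ hB).const_mul _),
    integral_sub ((hi _ hA).const_mul _) (integrable_const _), integral_const_mul,
    integral_const_mul, hI _ hA, hI _ hB, hI _ (hA.inter hB), image, neg_neg,
    measureReal_def μ (T t ⁻¹' A), (T.measurePreserving t).measure_preimage hA.nullMeasurableSet]
  simp [measureReal_def]

/-- For a weakly mixing flow the autocorrelations of a set at the times `τ, 2τ, …, Nτ` can be
made simultaneously small: the times `τ` for which one of them is large have density zero. -/
theorem IsWeaklyMixing.exists_small_correlations [IsProbabilityMeasure μ] {T : MeasureFlow μ}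
    (hT : T.IsWeaklyMixing) {A : Set X} (hA : MeasurableSet A) (N : ℕ) {ε : ℝ} (hε : 0 < ε) :
    ∃ τ : ℝ, ∀ j : ℕ, 1 ≤ j → j ≤ N →
      |∫ x, centeredIndicator μ A x * centeredIndicator μ A (T (j * τ) x) ∂μ| ≤ ε := by
  set φ : ℝ → ℝ := fun t =>
    |∫ x, centeredIndicator μ A x * centeredIndicator μ A (T (-t) x) ∂μ| with hφ
  have hφ_cont : Continuous φ :=
    ((T.continuous_integral_mul_comp (measurable_centeredIndicator hA)
      (abs_centeredIndicator_le_one A) (integrable_of_abs_le_one (measurable_centeredIndicator hA)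
      (abs_centeredIndicator_le_one A))).comp continuous_neg).abs
  have hφ_mean : Tendsto (fun L : ℝ => L⁻¹ * ∫ t in (0 : ℝ)..L, φ t) atTop (𝓝 0) := by
    have h := hT A A hA hA
    simp only [hφ, T.integral_centeredIndicator_mul_comp _ hA, neg_neg]
    exact h
  have hsum : Tendsto (fun L : ℝ => ∑ j ∈ Finset.Icc 1 N, L⁻¹ * ∫ t in (0 : ℝ)..L, φ (j * t))
      atTop (𝓝 0) := by
    have h : ∀ j ∈ Finset.Icc 1 N,
        Tendsto (fun L : ℝ => L⁻¹ * ∫ t in (0 : ℝ)..L, φ (j * t)) atTop (𝓝 0) := fun j hj => by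
      have hj0 : (0 : ℝ) < j := Nat.cast_pos.2 (Finset.mem_Icc.1 hj).1
      refine (hφ_mean.comp (tendsto_id.const_mul_atTop hj0)).congr fun L => ?_
      simp only [Function.comp_apply, id_eq]
      rw [intervalIntegral.integral_comp_mul_left _ hj0.ne', smul_eq_mul, mul_inv, mul_zero]
      ring
    have h' := tendsto_finsetSum _ h
    rwa [Finset.sum_const_zero] at h'
  obtain ⟨L, hLε, hL⟩ := ((hsum.eventually (gt_mem_nhds hε)).and (eventually_gt_atTop 0)).exists
  have hcont : ∀ j : ℕ, Continuous fun t : ℝ => φ (j * t) := fun j =>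
    hφ_cont.comp (continuous_const.mul continuous_id)
  -- the sum of the correlations is at most `ε` somewhere, since this holds on average
  have hex : ∃ t, ∑ j ∈ Finset.Icc 1 N, φ (j * t) ≤ ε := by
    by_contra! hlt
    have hle : ∫ _ in (0 : ℝ)..L, ε ≤ ∫ t in (0 : ℝ)..L, ∑ j ∈ Finset.Icc 1 N, φ (j * t) :=
      intervalIntegral.integral_mono_on hL.le (by simp)
        ((continuous_finsetSum _ fun j _ => hcont j).intervalIntegrable _ _)
        fun t _ => (hlt t).le
    rw [intervalIntegral.integral_finsetSum fun j _ => (hcont j).intervalIntegrable _ _,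
      intervalIntegral.integral_const, sub_zero, smul_eq_mul] at hle
    rw [← Finset.mul_sum, inv_mul_lt_iff₀ hL] at hLε
    linarith
  obtain ⟨t, ht⟩ := hex
  refine ⟨-t, fun j h1 hN => ?_⟩
  have h := Finset.single_le_sum (f := fun j : ℕ => φ (j * t)) (fun j _ => abs_nonneg _)
    (Finset.mem_Icc.2 ⟨h1, hN⟩)
  rw [mul_neg]
  exact h.trans ht

end MeasureFlow

/-! ### An averaged Cauchy–Schwarz inequality -/

section CauchySchwarz

variable {X : Type*} [MeasurableSpace X] {μ : Measure X}

theorem sq_integral_le_integral_sq [IsProbabilityMeasure μ] {f : X → ℝ} (hf : Integrable f μ)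
    (hf2 : Integrable (fun x => f x ^ 2) μ) : (∫ x, f x ∂μ) ^ 2 ≤ ∫ x, f x ^ 2 ∂μ := by
  set m := ∫ x, f x ∂μ with hm
  have h : 0 ≤ ∫ x, (f x - m) ^ 2 ∂μ := integral_nonneg fun x => sq_nonneg _
  have hpt : ∀ x, (f x - m) ^ 2 = f x ^ 2 - (2 * m * f x - m ^ 2) := fun x => by ring
  simp_rw [hpt] at h
  have h1 : Integrable (fun x => 2 * m * f x - m ^ 2) μ :=
    (hf.const_mul _).sub (integrable_const _)
  rw [integral_sub hf2 h1, integral_sub (hf.const_mul _) (integrable_const _),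
    integral_const_mul, ← hm] at h
  simp at h
  linarith

/-- The inequality behind the van der Corput trick: a common factor bounded by one is removed
from an average of integrals, at the price of squaring. -/
theorem sq_average_integral_mul_le [IsProbabilityMeasure μ] (N : ℕ) {u : X → ℝ} {P : ℕ → X → ℝ}
    (hu : Measurable u) (hu1 : ∀ x, |u x| ≤ 1) (hP : ∀ j, Measurable (P j))
    (hP1 : ∀ j x, |P j x| ≤ 1) :
    ((N : ℝ)⁻¹ * ∑ j ∈ Finset.range N, ∫ x, u x * P j x ∂μ) ^ 2
      ≤ ((N : ℝ)⁻¹) ^ 2 * ∑ i ∈ Finset.range N, ∑ j ∈ Finset.range N, ∫ x, P i x * P j x ∂μ := by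
  have hint1 : ∀ j, Integrable (fun x => u x * P j x) μ := fun j =>
    integrable_of_abs_le_one (hu.mul (hP j)) fun x => by
      rw [abs_mul]; exact mul_le_one₀ (hu1 x) (abs_nonneg _) (hP1 j x)
  have hint2 : ∀ i j, Integrable (fun x => P i x * P j x) μ := fun i j =>
    integrable_of_abs_le_one ((hP i).mul (hP j)) fun x => by
      rw [abs_mul]; exact mul_le_one₀ (hP1 i x) (abs_nonneg _) (hP1 j x)
  have hint3 : Integrable (fun x => (∑ j ∈ Finset.range N, P j x) ^ 2) μ := by
    simp_rw [sq, Finset.sum_mul_sum]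
    exact integrable_finsetSum _ fun i _ => integrable_finsetSum _ fun j _ => hint2 i j
  have hle : ∀ x, (∑ j ∈ Finset.range N, u x * P j x) ^ 2
      ≤ (∑ j ∈ Finset.range N, P j x) ^ 2 := fun x => by
    rw [← Finset.mul_sum, mul_pow]
    exact mul_le_of_le_one_left (sq_nonneg _) ((sq_le_one_iff_abs_le_one _).2 (hu1 x))
  have hint4 : Integrable (fun x => (∑ j ∈ Finset.range N, u x * P j x) ^ 2) μ :=
    hint3.mono' ((Finset.measurable_fun_sum _ fun j _ =>
      hu.mul (hP j)).pow_const 2).aestronglyMeasurable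
      (.of_forall fun x => by rw [Real.norm_of_nonneg (sq_nonneg _)]; exact hle x)
  rw [mul_pow]
  gcongr
  rw [← integral_finsetSum _ fun j _ => hint1 j]
  refine (sq_integral_le_integral_sq (integrable_finsetSum _ fun j _ => hint1 j) hint4).trans ?_
  refine (integral_mono hint4 hint3 hle).trans_eq ?_
  simp_rw [sq, Finset.sum_mul_sum]
  rw [integral_finsetSum _ fun i _ => integrable_finsetSum _ fun j _ => hint2 i j]
  exact Finset.sum_congr rfl fun i _ => integral_finsetSum _ fun j _ => hint2 i j

theorem average_le_of_offDiag_le {N : ℕ} (hN : 0 < N) {ε : ℝ} (hε : 0 ≤ ε) {a : ℕ → ℕ → ℝ}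
    (ha : ∀ i j, a i j ≤ 1) (ha' : ∀ i < N, ∀ j < N, i ≠ j → a i j ≤ ε) :
    ((N : ℝ)⁻¹) ^ 2 * ∑ i ∈ Finset.range N, ∑ j ∈ Finset.range N, a i j ≤ (N : ℝ)⁻¹ + ε := by
  have hN' : (0 : ℝ) < N := Nat.cast_pos.2 hN
  have h : ∑ i ∈ Finset.range N, ∑ j ∈ Finset.range N, a i j ≤ N + N ^ 2 * ε := by
    calc ∑ i ∈ Finset.range N, ∑ j ∈ Finset.range N, a i j
        ≤ ∑ i ∈ Finset.range N, ∑ j ∈ Finset.range N, ((if i = j then 1 else 0) + ε) := by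
          refine Finset.sum_le_sum fun i hi => Finset.sum_le_sum fun j hj => ?_
          split_ifs with hij
          · exact (ha i j).trans (by linarith)
          · simpa using ha' i (Finset.mem_range.1 hi) j (Finset.mem_range.1 hj) hij
      _ = N + N ^ 2 * ε := by
          have : ∀ i ∈ Finset.range N, (∑ j ∈ Finset.range N, ((if i = j then (1 : ℝ) else 0) + ε))
              = 1 + N * ε := fun i hi => by
            rw [Finset.sum_add_distrib, Finset.sum_ite_eq, if_pos hi]; simp
          rw [Finset.sum_congr rfl this]
          simp
          ring
  calc ((N : ℝ)⁻¹) ^ 2 * ∑ i ∈ Finset.range N, ∑ j ∈ Finset.range N, a i j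
      ≤ ((N : ℝ)⁻¹) ^ 2 * (N + N ^ 2 * ε) := by gcongr
    _ = (N : ℝ)⁻¹ + ε := by field_simp

end CauchySchwarz

/-! ### The correlations of a flow and the shift by the centre -/

namespace MeasureFlow

variable {X : Type*} [MeasurableSpace X] {μ : Measure X}

/-- The multiple correlation `∫ ∏ fᵢ(S_{bᵢ} x) dμ(x)` of the functions `fᵢ` along the times
`bᵢ` of a flow. -/
noncomputable def corr (S : MeasureFlow μ) {J : Type*} [Fintype J] (b : J → ℝ) (f : J → X → ℝ) :
    ℝ :=
  ∫ x, ∏ i, f i (S (b i) x) ∂μ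

theorem measurable_prod_comp (S : MeasureFlow μ) {J : Type*} [Fintype J] (b : J → ℝ)
    {f : J → X → ℝ} (hf : ∀ i, Measurable (f i)) : Measurable fun x => ∏ i, f i (S (b i) x) :=
  Finset.measurable_fun_prod _ fun i _ => (hf i).comp (S.measurable _)

theorem abs_corr_sub_corr_le [IsFiniteMeasure μ] (S : MeasureFlow μ) {J : Type*} [Fintype J]
    (b : J → ℝ) {f g : J → X → ℝ} (hf : ∀ i, Measurable (f i)) (hf1 : ∀ i x, |f i x| ≤ 1)
    (hg : ∀ i, Measurable (g i)) (hg1 : ∀ i x, |g i x| ≤ 1) :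
    |S.corr b f - S.corr b g| ≤ ∑ i, ∫ x, |f i x - g i x| ∂μ := by
  have hint : ∀ i, Integrable (fun x => |f i x - g i x|) μ := fun i =>
    ((integrable_of_abs_le_one (hf i) (hf1 i)).sub (integrable_of_abs_le_one (hg i) (hg1 i))).abs
  have hF := integrable_of_abs_le_one (μ := μ) (S.measurable_prod_comp b hf)
    fun x => abs_prod_le_one Finset.univ fun i => hf1 i (S (b i) x)
  have hG := integrable_of_abs_le_one (μ := μ) (S.measurable_prod_comp b hg)
    fun x => abs_prod_le_one Finset.univ fun i => hg1 i (S (b i) x)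
  have hint' : ∀ i, Integrable (fun x => |f i (S (b i) x) - g i (S (b i) x)|) μ := fun i =>
    S.integrable_comp (b i) (hint i)
  calc |S.corr b f - S.corr b g|
      ≤ ∫ x, |∏ i, f i (S (b i) x) - ∏ i, g i (S (b i) x)| ∂μ := by
        rw [corr, corr, ← integral_sub hF hG]
        exact abs_integral_le_integral_abs
    _ ≤ ∫ x, ∑ i, |f i (S (b i) x) - g i (S (b i) x)| ∂μ :=
        integral_mono (hF.sub hG).abs (integrable_finsetSum _ fun i _ => hint' i) fun x =>
          abs_prod_sub_prod_le _ (fun i => hf1 i _) fun i => hg1 i _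
    _ = ∑ i, ∫ x, |f i (S (b i) x) - g i (S (b i) x)| ∂μ :=
        integral_finsetSum _ fun i _ => hint' i
    _ = ∑ i, ∫ x, |f i x - g i x| ∂μ :=
        Finset.sum_congr rfl fun i _ => S.integral_comp (b i) (hint i).aestronglyMeasurable

/-- The Heisenberg relation for three flows: the commutator of `S_r` and `R_s` is `T_{κrs}`, and
`T` is central. The constant `κ` allows for exchanging the roles of `S` and `R`. -/
structure IsHeisenberg (S R T : MeasureFlow μ) (κ : ℝ) : Prop where
  rel : ∀ r s : ℝ, ∀ᵐ x ∂μ, S r (R s x) = T (κ * r * s) (R s (S r x))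
  comm_left : ∀ c r : ℝ, ∀ᵐ x ∂μ, T c (S r x) = S r (T c x)
  comm_right : ∀ c s : ℝ, ∀ᵐ x ∂μ, T c (R s x) = R s (T c x)

variable {S R T : MeasureFlow μ} {κ : ℝ}

theorem IsHeisenberg.comp_shift (h : IsHeisenberg S R T κ) (b b₀ s : ℝ) :
    ∀ᵐ x ∂μ, S b (R s (T (-(κ * b₀ * s)) x)) = R s (T (κ * (b - b₀) * s) (S b x)) := by
  have hS := (S.measurePreserving b).quasiMeasurePreserving
  filter_upwards [(T.measurePreserving (-(κ * b₀ * s))).quasiMeasurePreserving.ae (h.rel b s),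
    h.comm_left (-(κ * b₀ * s)) b, hS.ae (h.comm_right (-(κ * b₀ * s)) s),
    hS.ae (h.comm_right (κ * (b - b₀) * s) s),
    ((R.measurePreserving s).comp (S.measurePreserving b)).quasiMeasurePreserving.ae
      (T.map_add (κ * b * s) (-(κ * b₀ * s)))] with x h1 h2 h3 h4 h5
  rw [h1, ← h2, ← h3, ← h4]
  rw [Function.comp_apply] at h5
  rw [← h5]
  congr 1
  ring

theorem IsHeisenberg.corr_eq (h : IsHeisenberg S R T κ) {J : Type*} [Fintype J] (b : J → ℝ)
    (b₀ s : ℝ) {f : J → X → ℝ} (hf : ∀ i, Measurable (f i)) :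
    S.corr b f = S.corr b fun i x => f i (R s (T (κ * (b i - b₀) * s) x)) := by
  have hmp : MeasurePreserving (fun x => R s (T (-(κ * b₀ * s)) x)) μ μ :=
    (R.measurePreserving s).comp (T.measurePreserving _)
  rw [corr, ← hmp.integral_comp_aestronglyMeasurable
    (S.measurable_prod_comp b hf).aestronglyMeasurable, corr]
  refine integral_congr_ae ?_
  filter_upwards [ae_all_iff.2 fun i => h.comp_shift (b i) b₀ s] with x hx
  simp only [hx]

/-- Conjugation by `R_s` with `s → 0` such that `s` times the length of the time interval stays
fixed: the correlations of `S` are asymptotically invariant under the shift by `T` at speeds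
proportional to the positions of the times in the interval. -/
theorem IsHeisenberg.tendsto_corr_sub [IsFiniteMeasure μ] (h : IsHeisenberg S R T κ) (hκ : κ ≠ 0)
    {J : Type*} [Fintype J] {ι : Type*} {l : Filter ι} {b : ι → J → ℝ} {i₀ i₁ : J} {c : J → ℝ}
    (hb : Tendsto (fun p => b p i₁ - b p i₀) l atBot)
    (hc : ∀ i, Tendsto (fun p => (b p i - b p i₀) / (b p i₁ - b p i₀)) l (𝓝 (c i)))
    {f : J → X → ℝ} (hf : ∀ i, Measurable (f i)) (hf1 : ∀ i x, |f i x| ≤ 1) (t : ℝ) :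
    Tendsto (fun p => S.corr (b p) f - S.corr (b p) fun i x => f i (T (t * c i) x)) l (𝓝 0) := by
  have hint : ∀ i, Integrable (f i) μ := fun i => integrable_of_abs_le_one (hf i) (hf1 i)
  set s : ι → ℝ := fun p => t / κ / (b p i₁ - b p i₀) with hs
  have hs0 : Tendsto s l (𝓝 0) := hb.const_div_atBot _
  set d : ι → J → ℝ := fun p i => κ * (b p i - b p i₀) * s p with hd
  have hdt : ∀ p i, d p i = t * ((b p i - b p i₀) / (b p i₁ - b p i₀)) := fun p i => by
    simp only [hd, hs]
    field_simp
  have hd0 : ∀ i, Tendsto (fun p => d p i - t * c i) l (𝓝 0) := fun i => by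
    simpa [hdt] using ((hc i).const_mul t).sub_const (t * c i)
  have hlim : Tendsto (fun p => ∑ i, (∫ x, |f i (R (s p) x) - f i x| ∂μ
      + ∫ x, |f i (T (d p i - t * c i) x) - f i x| ∂μ)) l (𝓝 0) := by
    have h' := tendsto_finsetSum Finset.univ fun i _ =>
      ((R.tendsto_integral_abs_comp_sub (hint i)).comp hs0).add
        ((T.tendsto_integral_abs_comp_sub (hint i)).comp (hd0 i))
    simpa only [add_zero, Finset.sum_const_zero, Function.comp_apply] using h'
  refine squeeze_zero_norm (fun p => ?_) hlim
  rw [Real.norm_eq_abs, h.corr_eq (b p) (b p i₀) (s p) hf]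
  refine (S.abs_corr_sub_corr_le (b p)
    (fun i => (hf i).comp ((R.measurable _).comp (T.measurable _))) (fun i x => hf1 i _)
    (fun i => (hf i).comp (T.measurable _)) fun i x => hf1 i _).trans ?_
  refine Finset.sum_le_sum fun i _ => ?_
  have hR : Integrable (fun x => |f i (R (s p) x) - f i x|) μ :=
    ((R.integrable_comp _ (hint i)).sub (hint i)).abs
  rw [← T.integral_abs_comp_sub_comp (hint i),
    ← T.integral_comp (d p i) (f := fun x => |f i (R (s p) x) - f i x|) hR.aestronglyMeasurable]
  have hR' := T.integrable_comp (d p i) hR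
  have hT' := ((T.integrable_comp (d p i) (hint i)).sub (T.integrable_comp (t * c i) (hint i))).abs
  refine (integral_mono (((R.measurePreserving (s p)).comp
    (T.measurePreserving (d p i))).integrable_comp_of_integrable (hint i) |>.sub
    (T.integrable_comp (t * c i) (hint i))).abs (hR'.add hT') fun x => ?_).trans_eq
    (integral_add hR' hT')
  exact abs_sub_le _ _ _

end MeasureFlow

/-! ### Induction on the number of times -/

namespace MeasureFlow

variable {X : Type*} [MeasurableSpace X] {μ : Measure X} {S R T : MeasureFlow μ} {κ : ℝ}

/-- Mixing of a flow for `n` functions, along decreasing times whose gaps tend to infinity. The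
times are indexed by an arbitrary filter, so that one may pass to ultrafilters and omit times; the
functions are normalized to be bounded by one. -/
def IsTupleMixing (S : MeasureFlow μ) (n : ℕ) : Prop :=
  ∀ (ι : Type) (l : Filter ι) (b : ι → Fin n → ℝ),
    (∀ i j, i < j → Tendsto (fun p => b p i - b p j) l atTop) →
    ∀ f : Fin n → X → ℝ, (∀ i, Measurable (f i)) → (∀ i x, |f i x| ≤ 1) →
      Tendsto (fun p => S.corr (b p) f) l (𝓝 (∏ i, ∫ x, f i x ∂μ))

/-- Along an ultrafilter, the positions of the times relative to the whole time interval
converge. -/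
theorem exists_tendsto_ratio {n : ℕ} {ι : Type*} {l : Ultrafilter ι} {b : ι → Fin (n + 2) → ℝ}
    (hb : ∀ i j, i < j → Tendsto (fun p => b p i - b p j) l atTop) :
    ∃ c : Fin (n + 2) → ℝ, c 0 = 0 ∧ c (Fin.last _) = 1 ∧ ∀ i,
      Tendsto (fun p => (b p i - b p 0) / (b p (Fin.last _) - b p 0)) l (𝓝 (c i)) := by
  have hle : ∀ i j, i ≤ j → ∀ᶠ p in (l : Filter ι), b p j ≤ b p i := fun i j hij => by
    rcases hij.eq_or_lt with rfl | hlt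
    · exact .of_forall fun p => le_rfl
    · filter_upwards [(hb i j hlt).eventually_ge_atTop 0] with p hp
      linarith
  have hlt : ∀ᶠ p in (l : Filter ι), b p (Fin.last _) < b p 0 := by
    filter_upwards [(hb 0 (Fin.last _) (Fin.last_pos)).eventually_gt_atTop 0] with p hp
    linarith
  have hex : ∀ i, ∃ c : ℝ,
      Tendsto (fun p => (b p i - b p 0) / (b p (Fin.last _) - b p 0)) l (𝓝 c) := by
    intro i
    obtain ⟨c, -, hc⟩ := (isCompact_Icc (a := (0 : ℝ)) (b := 1)).ultrafilter_le_nhds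
      (l.map fun p => (b p i - b p 0) / (b p (Fin.last _) - b p 0)) (by
        rw [le_principal_iff]
        change ∀ᶠ p in (l : Filter ι), _ ∈ Icc (0 : ℝ) 1
        filter_upwards [hle 0 i (Fin.zero_le i), hle i _ (Fin.le_last i), hlt] with p h1 h2 h3
        exact ⟨div_nonneg_of_nonpos (by linarith) (by linarith),
          (div_le_one_of_neg (by linarith)).2 (by linarith)⟩)
    exact ⟨c, hc⟩
  choose c hc using hex
  refine ⟨c, tendsto_nhds_unique (hc 0) (by simp),
    tendsto_nhds_unique (hc _) (tendsto_const_nhds.congr' ?_), hc⟩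
  filter_upwards [hlt] with p hp
  rw [div_self (by linarith)]

/-- The heart of the inductive step. The correlation is asymptotically invariant under shifts by
`T` at speeds proportional to the times; averaging over finitely many shifts, removing the first
factor by the Cauchy–Schwarz inequality and using mixing for one function less, it is bounded by
the autocorrelations of the last function under `T`. -/
theorem IsHeisenberg.tendsto_corr_zero [IsProbabilityMeasure μ] (h : IsHeisenberg S R T κ)
    (hκ : κ ≠ 0) {n : ℕ} (ih : S.IsTupleMixing (n + 1)) {ι : Type} {l : Ultrafilter ι}
    {b : ι → Fin (n + 2) → ℝ} (hb : ∀ i j, i < j → Tendsto (fun p => b p i - b p j) l atTop)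
    {f : Fin (n + 2) → X → ℝ} (hf : ∀ i, Measurable (f i)) (hf1 : ∀ i x, |f i x| ≤ 1)
    (hsmall : ∀ (N : ℕ) (ε : ℝ), 0 < ε → ∃ τ : ℝ, ∀ j : ℕ, 1 ≤ j → j ≤ N →
      |∫ x, f (Fin.last _) x * f (Fin.last _) (T (j * τ) x) ∂μ| ≤ ε) :
    Tendsto (fun p => S.corr (b p) f) l (𝓝 0) := by
  obtain ⟨c, hc0, hc1, hc⟩ := exists_tendsto_ratio hb
  have hbot : Tendsto (fun p => b p (Fin.last _) - b p 0) l atBot := by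
    simpa [Function.comp_def] using
      tendsto_neg_atTop_atBot.comp (hb 0 (Fin.last _) Fin.last_pos)
  rw [Metric.tendsto_nhds]
  intro δ hδ
  -- `N` and `ε` are such that `1 / N + ε < (δ / 2) ^ 2`
  obtain ⟨N, hN⟩ := exists_nat_gt (8 / δ ^ 2)
  have hN0 : (0 : ℝ) < N := lt_trans (by positivity) hN
  obtain ⟨τ, hτ⟩ := hsmall N (δ ^ 2 / 8) (by positivity)
  have hNε : (N : ℝ)⁻¹ + δ ^ 2 / 8 < (δ / 2) ^ 2 := by
    have : (N : ℝ)⁻¹ < δ ^ 2 / 8 := by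
      rw [inv_lt_comm₀ hN0 (by positivity), inv_div]
      exact hN
    linarith
  -- the functions after the `j`-th shift
  set g : ℕ → Fin (n + 2) → X → ℝ := fun j i x => f i (T (j * τ * c i) x) with hg
  have hgm : ∀ j i, Measurable (g j i) := fun j i => (hf i).comp (T.measurable _)
  have hg1 : ∀ j i x, |g j i x| ≤ 1 := fun j i x => hf1 i _
  have hg0 : ∀ j, g j 0 =ᵐ[μ] f 0 := fun j => by
    filter_upwards [T.map_zero] with x hx
    simp only [hg, hc0, mul_zero, hx]
  have hglast : ∀ i j : ℕ, i ≤ j → ∫ x, g i (Fin.last _) x * g j (Fin.last _) x ∂μ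
      = ∫ x, f (Fin.last _) x * f (Fin.last _) (T ((j - i : ℕ) * τ) x) ∂μ := fun i j hij => by
    rw [← T.integral_comp (i * τ)
      (f := fun x => f (Fin.last _) x * f (Fin.last _) (T ((j - i : ℕ) * τ) x))
      ((hf _).mul ((hf _).comp (T.measurable _))).aestronglyMeasurable]
    refine integral_congr_ae ?_
    filter_upwards [T.map_add ((j - i : ℕ) * τ) (i * τ)] with x hx
    simp only [hg, hc1, mul_one]
    rw [← hx, Nat.cast_sub hij]
    ring_nf
  -- the remaining functions, after removal of the first one and squaring
  set q : ℕ → ℕ → Fin (n + 1) → X → ℝ := fun i j k x => g i k.succ x * g j k.succ x with hq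
  have hqm : ∀ i j k, Measurable (q i j k) := fun i j k => (hgm i _).mul (hgm j _)
  have hq1 : ∀ i j k x, |q i j k x| ≤ 1 := fun i j k x => by
    rw [hq, abs_mul]; exact mul_le_one₀ (hg1 i _ x) (abs_nonneg _) (hg1 j _ x)
  set V : ι → ℝ := fun p => (N : ℝ)⁻¹ * ∑ j ∈ Finset.range N, S.corr (b p) (g j) with hV
  set Q : ι → ℝ := fun p => ((N : ℝ)⁻¹) ^ 2 * ∑ i ∈ Finset.range N, ∑ j ∈ Finset.range N,
    S.corr (fun k : Fin (n + 1) => b p k.succ) (q i j) with hQ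
  have hshift : Tendsto (fun p => S.corr (b p) f - V p) l (𝓝 0) := by
    have h1 := (tendsto_finsetSum (Finset.range N) fun (j : ℕ) _ =>
      h.tendsto_corr_sub hκ hbot hc hf hf1 (j * τ)).const_mul (N : ℝ)⁻¹
    simp only [Finset.sum_const_zero, mul_zero] at h1
    refine h1.congr fun p => ?_
    rw [Finset.sum_sub_distrib, mul_sub, Finset.sum_const, Finset.card_range, nsmul_eq_mul,
      inv_mul_cancel_left₀ hN0.ne']
  have hVQ : ∀ p, V p ^ 2 ≤ Q p := by
    intro p
    have hcs := sq_average_integral_mul_le (μ := μ) N (u := fun x => f 0 (S (b p 0) x))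
      (P := fun j x => ∏ k : Fin (n + 1), g j k.succ (S (b p k.succ) x))
      ((hf 0).comp (S.measurable _)) (fun x => hf1 0 _)
      (fun j => S.measurable_prod_comp (fun k : Fin (n + 1) => b p k.succ) fun k => hgm j k.succ)
      (fun j x => abs_prod_le_one _ fun k => hg1 j _ _)
    simp_rw [← Finset.prod_mul_distrib] at hcs
    have hVeq : ∀ j, S.corr (b p) (g j) = ∫ x, f 0 (S (b p 0) x) *
        ∏ k : Fin (n + 1), g j k.succ (S (b p k.succ) x) ∂μ := fun j => by
      refine integral_congr_ae ?_
      filter_upwards [(S.measurePreserving (b p 0)).quasiMeasurePreserving.ae (hg0 j)] with x hx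
      rw [Fin.prod_univ_succ, hx]
    simp only [hV, hVeq]
    exact hcs
  have hQlim : Tendsto Q l (𝓝 (((N : ℝ)⁻¹) ^ 2 * ∑ i ∈ Finset.range N, ∑ j ∈ Finset.range N,
      ∏ k, ∫ x, q i j k x ∂μ)) :=
    (tendsto_finsetSum _ fun i _ => tendsto_finsetSum _ fun j _ =>
      ih ι l (fun p k => b p k.succ) (fun k k' hk => hb _ _ (Fin.succ_lt_succ_iff.2 hk))
        (q i j) (hqm i j) (hq1 i j)).const_mul _
  have hQle : ((N : ℝ)⁻¹) ^ 2 * ∑ i ∈ Finset.range N, ∑ j ∈ Finset.range N,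
      ∏ k, ∫ x, q i j k x ∂μ ≤ (N : ℝ)⁻¹ + δ ^ 2 / 8 := by
    refine average_le_of_offDiag_le (Nat.cast_pos.1 hN0) (by positivity) (fun i j =>
      (le_abs_self _).trans (abs_prod_le_one _ fun k => abs_integral_le_one (hq1 i j k)))
      fun i hi j hj hij => (le_abs_self _).trans ?_
    rw [Fin.prod_univ_castSucc, abs_mul]
    refine (mul_le_of_le_one_left (abs_nonneg _)
      (abs_prod_le_one _ fun k => abs_integral_le_one (hq1 i j _))).trans ?_
    simp only [hq, Fin.succ_last]
    rcases hij.lt_or_gt with hlt | hlt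
    · rw [hglast i j hlt.le]
      exact hτ _ (by omega) (by omega)
    · simp_rw [mul_comm (g i _ _)]
      rw [hglast j i hlt.le]
      exact hτ _ (by omega) (by omega)
  filter_upwards [hshift.eventually (Metric.ball_mem_nhds 0 (half_pos hδ)),
    hQlim.eventually (gt_mem_nhds (hQle.trans_lt hNε))] with p hp1 hp2
  have hVp : |V p| < δ / 2 := abs_lt_of_sq_lt_sq ((hVQ p).trans_lt hp2) (half_pos hδ).le
  rw [Real.dist_eq, sub_zero] at hp1
  rw [Real.dist_eq, sub_zero]
  have := abs_add_le (S.corr (b p) f - V p) (V p)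
  rw [sub_add_cancel] at this
  linarith

/-- One more function: centred indicators in the last place are handled by
`IsHeisenberg.tendsto_corr_zero`, constants by the induction hypothesis, and general functions by
approximation. -/
theorem IsHeisenberg.isTupleMixing_succ [IsProbabilityMeasure μ] (h : IsHeisenberg S R T κ)
    (hκ : κ ≠ 0) (hT : T.IsWeaklyMixing) {n : ℕ} (ih : S.IsTupleMixing (n + 1)) :
    S.IsTupleMixing (n + 2) := by
  intro ι l b hb f hf hf1
  rw [tendsto_iff_ultrafilter]
  intro U hU
  have hbU : ∀ i j, i < j → Tendsto (fun p => b p i - b p j) U atTop := fun i j hij =>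
    (hb i j hij).mono_left hU
  -- the product of all factors but the last one, and its limit
  set P : ι → X → ℝ := fun p x => ∏ i : Fin (n + 1), f i.castSucc (S (b p i.castSucc) x) with hP
  set m : ℝ := ∏ i : Fin (n + 1), ∫ x, f i.castSucc x ∂μ with hm
  have hPm : ∀ p, Measurable (P p) := fun p =>
    S.measurable_prod_comp (fun i : Fin (n + 1) => b p i.castSucc) fun i => hf i.castSucc
  have hP1 : ∀ p x, |P p x| ≤ 1 := fun p x => abs_prod_le_one _ fun i => hf1 _ _
  have hm1 : |m| ≤ 1 := abs_prod_le_one _ fun i => abs_integral_le_one (hf1 _)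
  have hPlim : Tendsto (fun p => ∫ x, P p x ∂μ) U (𝓝 m) :=
    ih ι U (fun p i => b p i.castSucc) (fun i j hij => hbU _ _ (Fin.castSucc_lt_castSucc_iff.2 hij))
      (fun i => f i.castSucc) (fun i => hf _) fun i => hf1 _
  have hint : ∀ p (g : X → ℝ), Integrable g μ →
      Integrable (fun x => P p x * g (S (b p (Fin.last _)) x)) μ := fun p g hg =>
    (S.integrable_comp _ hg).bdd_mul (hPm p).aestronglyMeasurable (.of_forall (hP1 p))
  have hcorr : ∀ p (g : X → ℝ), S.corr (b p) (Fin.snoc (fun i : Fin (n + 1) => f i.castSucc) g)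
      = ∫ x, P p x * g (S (b p (Fin.last _)) x) ∂μ := fun p g => by
    simp [corr, Fin.prod_univ_castSucc, hP]
  have hcentered : ∀ A, MeasurableSet A → Tendsto (fun p =>
      ∫ x, P p x * centeredIndicator μ A (S (b p (Fin.last _)) x) ∂μ) U (𝓝 0) := by
    intro A hA
    simp_rw [← hcorr]
    refine h.tendsto_corr_zero hκ ih hbU (fun i => ?_) (fun i => ?_) fun N ε hε => ?_
    · refine Fin.lastCases ?_ (fun i => ?_) i
      · simpa using measurable_centeredIndicator hA
      · simpa using hf _
    · refine Fin.lastCases ?_ (fun i => ?_) i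
      · simpa using abs_centeredIndicator_le_one A
      · simpa using hf1 _
    · simpa using hT.exists_small_correlations hA N hε
  have hdense : Tendsto (fun p => |∫ x, P p x * f (Fin.last _) (S (b p (Fin.last _)) x) ∂μ
      - m * ∫ x, f (Fin.last _) x ∂μ|) U (𝓝 0) := by
    refine tendsto_zero_of_indicator (μ := μ)
      (fun p g => |∫ x, P p x * g (S (b p (Fin.last _)) x) ∂μ - m * ∫ x, g x ∂μ|) 2
      (fun _ _ => abs_nonneg _) ?_ ?_ ?_ (integrable_of_abs_le_one (hf _) (hf1 _))
    · intro p g g' hg hg'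
      have h1 : ∫ x, P p x * (g + g') (S (b p (Fin.last _)) x) ∂μ
          = ∫ x, P p x * g (S (b p (Fin.last _)) x) ∂μ
            + ∫ x, P p x * g' (S (b p (Fin.last _)) x) ∂μ := by
        simp_rw [Pi.add_apply, mul_add]
        exact integral_add (hint p g hg) (hint p g' hg')
      rw [h1, integral_add' hg hg', mul_add, add_sub_add_comm]
      exact abs_add_le _ _
    · intro p g hg
      have h1 : |∫ x, P p x * g (S (b p (Fin.last _)) x) ∂μ| ≤ ∫ x, |g x| ∂μ := by
        rw [← S.integral_comp (b p (Fin.last _)) (f := fun x => |g x|)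
          hg.abs.aestronglyMeasurable]
        refine abs_integral_le_integral_abs.trans (integral_mono (hint p g hg).abs
          (S.integrable_comp _ hg).abs fun x => ?_)
        simp only [abs_mul]
        exact mul_le_of_le_one_left (abs_nonneg _) (hP1 p x)
      have h2 : |m * ∫ x, g x ∂μ| ≤ ∫ x, |g x| ∂μ := by
        rw [abs_mul]
        exact (mul_le_of_le_one_left (abs_nonneg _) hm1).trans abs_integral_le_integral_abs
      exact (abs_sub _ _).trans (by linarith)
    · intro a A hA
      have hlim := (((hcentered A hA).add (hPlim.mul_const (μ.real A))).const_mul a).sub_const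
        (a * (m * μ.real A))
      rw [zero_add, sub_self] at hlim
      refine (abs_zero (α := ℝ) ▸ hlim.abs).congr fun p => ?_
      have hc := integrable_of_abs_le_one (μ := μ) (measurable_centeredIndicator (μ := μ) hA)
        (abs_centeredIndicator_le_one A)
      have h1 : ∀ x, P p x * A.indicator (fun _ => a) (S (b p (Fin.last _)) x)
          = a * (P p x * centeredIndicator μ A (S (b p (Fin.last _)) x) + P p x * μ.real A) := by
        intro x
        by_cases hx : S (b p (Fin.last _)) x ∈ A <;> simp [centeredIndicator, hx]
        ring
      simp_rw [h1]
      rw [integral_const_mul, integral_add (hint p _ hc)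
        ((integrable_of_abs_le_one (hPm p) (hP1 p)).mul_const _), integral_mul_const,
        integral_indicator_const _ hA, smul_eq_mul]
      congr 1
      ring
  rw [Fin.prod_univ_castSucc, ← hm, tendsto_iff_dist_tendsto_zero]
  refine hdense.congr fun p => ?_
  simp only [Real.dist_eq, corr, Fin.prod_univ_castSucc, hP]

theorem IsHeisenberg.isTupleMixing [IsProbabilityMeasure μ] (h : IsHeisenberg S R T κ)
    (hκ : κ ≠ 0) (hT : T.IsWeaklyMixing) (n : ℕ) : S.IsTupleMixing (n + 1) := by
  induction n with
  | zero =>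
    intro ι l b _ f hf _
    simp only [corr, Fin.prod_univ_succ, Fin.prod_univ_zero, mul_one]
    simp only [S.integral_comp _ (hf 0).aestronglyMeasurable]
    exact tendsto_const_nhds
  | succ n ih => exact h.isTupleMixing_succ hκ hT ih

/-- Mixing for bounded functions applied to indicator functions, with the time of `A_i` equal to
`-(m₁ + ⋯ + m_i)`, since images of sets are preimages under the inverse. -/
theorem IsTupleMixing.isMixingOfOrder [IsProbabilityMeasure μ] {k : ℕ}
    (hS : S.IsTupleMixing (k + 1)) : S.IsMixingOfOrder k := by
  intro A hA
  have hgap : ∀ i j : Fin (k + 1), i < j → Tendsto (fun m : Fin k → ℝ =>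
      -(∑ a : Fin k with a.val < i.val, m a) - -(∑ a : Fin k with a.val < j.val, m a))
      (Filter.pi fun _ => atTop) atTop := by
    intro i j hij
    have hi : i.val < k := by omega
    have hlim : Tendsto (fun m : Fin k → ℝ => m ⟨i, hi⟩) (Filter.pi fun _ => atTop) atTop :=
      tendsto_eval_pi _ _
    have hnonneg : ∀ᶠ m : Fin k → ℝ in Filter.pi fun _ => atTop, ∀ a, 0 ≤ m a :=
      eventually_all.2 fun a => (tendsto_eval_pi (fun _ : Fin k => (atTop : Filter ℝ)) a).eventually
        (eventually_ge_atTop 0)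
    refine tendsto_atTop_mono' _ ?_ hlim
    filter_upwards [hnonneg] with m hm
    have hsub : insert ⟨i, hi⟩ (Finset.univ.filter fun a : Fin k => a.val < i.val)
        ⊆ Finset.univ.filter fun a : Fin k => a.val < j.val := by
      intro a ha
      simp only [Finset.mem_insert, Finset.mem_filter, Finset.mem_univ, true_and] at ha ⊢
      rcases ha with rfl | ha
      · exact hij
      · exact ha.trans hij
    have hle := Finset.sum_le_sum_of_subset_of_nonneg (f := m) hsub fun a _ _ => hm a
    rw [Finset.sum_insert (by simp)] at hle
    linarith
  have hlim := hS (Fin k → ℝ) (Filter.pi fun _ => atTop)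
    (fun m i => -(∑ a : Fin k with a.val < i.val, m a)) hgap
    (fun i => (A i).indicator fun _ => (1 : ℝ)) (fun i => measurable_const.indicator (hA i))
    (fun i x => by by_cases hx : x ∈ A i <;> simp [hx])
  have hI : ∀ B : Set X, MeasurableSet B →
      ∫ x, B.indicator (fun _ => (1 : ℝ)) x ∂μ = μ.real B := fun B hB => by
    simp [integral_indicator_const _ hB]
  simp_rw [hI _ (hA _)] at hlim
  refine hlim.congr fun m => ?_
  simp only [image]
  rw [← hI _ (MeasurableSet.iInter fun i => S.measurable _ (hA i)), corr]
  congr 1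
  ext x
  by_cases hx : ∀ i, S (-(∑ a : Fin k with a.val < i.val, m a)) x ∈ A i
  · rw [indicator_of_mem (mem_iInter.2 hx)]
    exact Finset.prod_eq_one fun i _ => indicator_of_mem (hx i) _
  · rw [indicator_of_notMem fun h => hx (mem_iInter.1 h)]
    push Not at hx
    obtain ⟨i, hi⟩ := hx
    exact Finset.prod_eq_zero (Finset.mem_univ i) (indicator_of_notMem hi _)

end MeasureFlow

theorem mainTheorem4 {X : Type*} [MeasurableSpace X] (μ : Measure X) [IsProbabilityMeasure μ]
    (Ψ Φ T : MeasureFlow μ)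
    (hΨ : Ψ.IsErgodic) (hΦ : Φ.IsErgodic) (hT : T.IsErgodic)
    (hrel : ∀ r s : ℝ, ∀ᵐ x ∂μ, Ψ r (Φ s x) = T (r * s) (Φ s (Ψ r x)))
    (hTΨ : ∀ c r : ℝ, ∀ᵐ x ∂μ, T c (Ψ r x) = Ψ r (T c x))
    (hTΦ : ∀ c s : ℝ, ∀ᵐ x ∂μ, T c (Φ s x) = Φ s (T c x))
    (hmix : T.IsWeaklyMixing) :
    ∀ k : ℕ, 1 ≤ k → Ψ.IsMixingOfOrder k ∧ Φ.IsMixingOfOrder k := by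
  have hΨΦ : MeasureFlow.IsHeisenberg Ψ Φ T 1 :=
    ⟨fun r s => by simpa only [one_mul] using hrel r s, hTΨ, hTΦ⟩
  have hΦΨ : MeasureFlow.IsHeisenberg Φ Ψ T (-1) := by
    refine ⟨fun r s => ?_, hTΦ, hTΨ⟩
    filter_upwards [hrel s r,
      ((Φ.measurePreserving r).comp (Ψ.measurePreserving s)).quasiMeasurePreserving.ae
        (T.map_add (-1 * r * s) (s * r)),
      ((Φ.measurePreserving r).comp (Ψ.measurePreserving s)).quasiMeasurePreserving.ae
        T.map_zero] with x h1 h2 h3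
    rw [Function.comp_apply] at h2 h3
    rw [h1, ← h2, show -1 * r * s + s * r = 0 by ring, h3]
  exact fun k _ => ⟨(hΨΦ.isTupleMixing one_ne_zero hmix k).isMixingOfOrder,
    (hΦΨ.isTupleMixing (by norm_num) hmix k).isMixingOfOrder⟩
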